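/- Let $n,m,r\in\mathbb N$, and let $A,C\in\mathbb R^{n\times n}$, $B,D\in\mathbb R^{n\times m}$ be real matrices. Let $w_0,w_1,\dots$ be independent real square-integrable random variables on a probability space with $\mathbb E w_k=0$ and $\mathbb E(w_kw_s)=\delta_{ks}$, and consider the system $x_{k+1}=Ax_k+Bu_k+(Cx_k+Du_k)w_k$ with deterministic $x_0=z\in\mathbb R^n$. Let $Q\in\mathbb R^{n\times n}$, $R\in\mathbb R^{m\times m}$ be symmetric with $Q\succeq 0$, $R\succ 0$. Assume that (i) the system is stabilizable: for some $F\in\mathbb R^{m\times n}$, the closed loop $x_{k+1}=(A+BF)x_k+(C+DF)x_kw_k$ satisfies $\mathbb E(x_k'x_k)\to0$ for every $z$; (ii) $(A,C|Q)$ is exactly observable or exactly detectable: there is an integer $T\ge 1$ such that, for every solution of $x_{k+1}=Ax_k+Cx_kw_k$, $x_0=z$, with $Qx_k=0$ almost surely for $k=0,\dots,T$, one has $z=0$ (respectively $\mathbb E\|x_k\|^2\to 0$). Put $\Lambda=\begin{bmatrix}Q&0\\0&R\end{bmatrix}$ and, for $F\in\mathbb R^{m\times n}$, $$A_F=\begin{bmatrix}A&B\\FA&FB\end{bmatrix},\qquad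 C_F=\begin{bmatrix}C&D\\FC&FD\end{bmatrix}.$$ Let $v_0^1,\dots,v_0^r\in\mathbb R^{n+m}$ be such that $\Xi=\sum_{l=1}^r v_0^l(v_0^l)'\succ0$. The primal problem $(\hat{\mathcal P}_1\text{-SLQR})$ is to minimize $\mathrm{Tr}(\Lambda\widetilde S)$ over symmetric $\widetilde S\in\mathbb R^{(n+m)\times(n+m)}$ and $F\in\mathbb R^{m\times n}$ subject to $$A_F\widetilde SA_F'+C_F\widetilde SC_F'+\Xi=\widetilde S,\qquad \widetilde S\succ0.$$ Its Lagrangian is $$\hat L(X,F,\widetilde S,X_0)=\mathrm{Tr}(X\Xi)+\mathrm{Tr}\big[(A_F'XA_F+C_F'XC_F-X-X_0+\Lambda)\widetilde S\big],$$ and its dual problem is to maximize $\inf_{\widetilde S\succ0,\;F\in\mathbb R^{m\times n}}\hat L(X,F,\widetilde S,X_0)\in[-\infty,\infty)$ over symmetric $X$ and symmetric $X_0\succeq0$ in $\mathbb R^{(n+m)\times(n+m)}$. Let $(\widetilde S^*,F^*)$ be an optimal point of the primal problem and $(X^*,X_0^*)$ an optimal point of the dual problem. Write $X^*=\begin{bmatrix}X_{11}&X_{12}\\X_{12}'&X_{22}\end{bmatrix}$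 with $X_{11}\in\mathbb R^{n\times n}$, $X_{22}\in\mathbb R^{m\times m}$, and $$\Psi=\begin{bmatrix}A&B\end{bmatrix}\widetilde S^*\begin{bmatrix}A&B\end{bmatrix}'+\begin{bmatrix}C&D\end{bmatrix}\widetilde S^*\begin{bmatrix}C&D\end{bmatrix}'.$$ Then the following KKT conditions hold: $$A_{F^*}\widetilde S^*A_{F^*}'+C_{F^*}\widetilde S^*C_{F^*}'+\Xi-\widetilde S^*=0,\qquad \widetilde S^*\succ0,$$ $$A_{F^*}'X^*A_{F^*}+C_{F^*}'X^*C_{F^*}+\Lambda-X^*=0,$$ $$(X_{12}'+X_{22}F^*)\Psi=0,\qquad X_0^*=0.$$ -/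

import Mathlib

open Matrix MeasureTheory ProbabilityTheory Filter Topology

noncomputable section

namespace SLQR

/-- The noise: a sequence of real independent square integrable random variables with
`E w_k = 0` and `E (w_k w_s) = δ_{ks}`. -/
structure IsNoise {Ω : Type*} [MeasurableSpace Ω] (μ : Measure Ω) (w : ℕ → Ω → ℝ) : Prop where
  measurable : ∀ k, Measurable (w k)
  memLp : ∀ k, MemLp (w k) 2 μ
  indep : iIndepFun w μ
  mean_zero : ∀ k, ∫ ω, w k ω ∂μ = 0
  covariance : ∀ k s, ∫ ω, w k ω * w s ω ∂μ = if k = s then 1 else 0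

/-- The solution of `x_{k+1} = A x_k + C x_k w_k`, `x_0 = z`. -/
def traj {Ω : Type*} {n : ℕ} (A C : Matrix (Fin n) (Fin n) ℝ) (w : ℕ → Ω → ℝ)
    (z : Fin n → ℝ) : ℕ → Ω → (Fin n → ℝ)
  | 0, _ => z
  | k + 1, ω => A *ᵥ traj A C w z k ω + w k ω • (C *ᵥ traj A C w z k ω)

/-- The second moment `E (x_k' x_k)` tends to `0` along the solution of
`x_{k+1} = A x_k + C x_k w_k` that starts at `z`. -/
def MeanSquareDecay {Ω : Type*} [MeasurableSpace Ω] (μ : Measure Ω) (w : ℕ → Ω → ℝ) {n : ℕ}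
    (A C : Matrix (Fin n) (Fin n) ℝ) (z : Fin n → ℝ) : Prop :=
  Tendsto (fun k => ∫ ω, traj A C w z k ω ⬝ᵥ traj A C w z k ω ∂μ) atTop (𝓝 0)

/-- `[A; C]` is asymptotically stable in mean square. -/
def ASMS {Ω : Type*} [MeasurableSpace Ω] (μ : Measure Ω) (w : ℕ → Ω → ℝ) {n : ℕ}
    (A C : Matrix (Fin n) (Fin n) ℝ) : Prop :=
  ∀ z, MeanSquareDecay μ w A C z

/-- `[A, B; C, D]` is stabilizable by a constant state feedback `u_k = F x_k`. -/
def Stabilizable {Ω : Type*} [MeasurableSpace Ω] (μ : Measure Ω) (w : ℕ → Ω → ℝ) {n m : ℕ}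
    (A : Matrix (Fin n) (Fin n) ℝ) (B : Matrix (Fin n) (Fin m) ℝ)
    (C : Matrix (Fin n) (Fin n) ℝ) (D : Matrix (Fin n) (Fin m) ℝ) : Prop :=
  ∃ F : Matrix (Fin m) (Fin n) ℝ, ASMS μ w (A + B * F) (C + D * F)

/-- Exact observability of `(A, C | Q)`: for some horizon `T`, if the output `y_k = Q x_k` vanishes
almost surely for `k = 0, …, T`, then `x_0 = 0`. -/
def ExactlyObservable {Ω : Type*} [MeasurableSpace Ω] (μ : Measure Ω) (w : ℕ → Ω → ℝ) {n : ℕ}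
    (A C Q : Matrix (Fin n) (Fin n) ℝ) : Prop :=
  ∃ T : ℕ, 0 < T ∧ ∀ z : Fin n → ℝ,
    (∀ k ≤ T, ∀ᵐ ω ∂μ, Q *ᵥ traj A C w z k ω = 0) → z = 0

/-- Exact detectability of `(A, C | Q)`: for some horizon `T`, if the output `y_k = Q x_k` vanishes
almost surely for `k = 0, …, T`, then `E ‖x_k‖² → 0`. -/
def ExactlyDetectable {Ω : Type*} [MeasurableSpace Ω] (μ : Measure Ω) (w : ℕ → Ω → ℝ) {n : ℕ}
    (A C Q : Matrix (Fin n) (Fin n) ℝ) : Prop :=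
  ∃ T : ℕ, 0 < T ∧ ∀ z : Fin n → ℝ,
    (∀ k ≤ T, ∀ᵐ ω ∂μ, Q *ᵥ traj A C w z k ω = 0) → MeanSquareDecay μ w A C z

/-- Square matrices of size `n + m`, in blocks of sizes `n` and `m`. -/
abbrev BMat (n m : ℕ) := Matrix (Fin n ⊕ Fin m) (Fin n ⊕ Fin m) ℝ

/-- `M_F = [M, N; F M, F N]`; this is `A_F` for `(M, N) = (A, B)` and `C_F` for
`(M, N) = (C, D)`. -/
def aug {n m : ℕ} (M : Matrix (Fin n) (Fin n) ℝ) (N : Matrix (Fin n) (Fin m) ℝ)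
    (F : Matrix (Fin m) (Fin n) ℝ) : BMat n m :=
  fromBlocks M N (F * M) (F * N)

/-- `Λ = diag(Q, R)`. -/
def weight {n m : ℕ} (Q : Matrix (Fin n) (Fin n) ℝ) (R : Matrix (Fin m) (Fin m) ℝ) : BMat n m :=
  fromBlocks Q 0 0 R

/-- `Ξ = ∑ l, v_l v_l'`. -/
def gram {n m r : ℕ} (v : Fin r → (Fin n ⊕ Fin m → ℝ)) : BMat n m :=
  ∑ l, vecMulVec (v l) (v l)

/-- Feasibility of `(S, F)` in the modified primal problem:
`A_F S A_F' + C_F S C_F' + Ξ = S` and `S ≻ 0`. -/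
def PrimalFeasible {n m : ℕ} (A : Matrix (Fin n) (Fin n) ℝ) (B : Matrix (Fin n) (Fin m) ℝ)
    (C : Matrix (Fin n) (Fin n) ℝ) (D : Matrix (Fin n) (Fin m) ℝ) (Ξ : BMat n m)
    (S : BMat n m) (F : Matrix (Fin m) (Fin n) ℝ) : Prop :=
  S.IsSymm ∧
  aug A B F * S * (aug A B F)ᵀ + aug C D F * S * (aug C D F)ᵀ + Ξ = S ∧
  S.PosDef

/-- `(S, F)` is feasible and minimizes `Tr (Λ S)` among the feasible points. -/
def PrimalOptimal {n m : ℕ} (A : Matrix (Fin n) (Fin n) ℝ) (B : Matrix (Fin n) (Fin m) ℝ)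
    (C : Matrix (Fin n) (Fin n) ℝ) (D : Matrix (Fin n) (Fin m) ℝ) (Λ Ξ : BMat n m)
    (S : BMat n m) (F : Matrix (Fin m) (Fin n) ℝ) : Prop :=
  PrimalFeasible A B C D Ξ S F ∧
  ∀ S' F', PrimalFeasible A B C D Ξ S' F' → trace (Λ * S) ≤ trace (Λ * S')

/-- The Lagrangian of the modified primal problem. -/
def lagrangian {n m : ℕ} (A : Matrix (Fin n) (Fin n) ℝ) (B : Matrix (Fin n) (Fin m) ℝ)
    (C : Matrix (Fin n) (Fin n) ℝ) (D : Matrix (Fin n) (Fin m) ℝ) (Λ Ξ : BMat n m)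
    (X : BMat n m) (F : Matrix (Fin m) (Fin n) ℝ) (S X₀ : BMat n m) : ℝ :=
  trace (X * Ξ) +
    trace (((aug A B F)ᵀ * X * aug A B F + (aug C D F)ᵀ * X * aug C D F - X - X₀ + Λ) * S)

/-- The dual function: the infimum of the Lagrangian over `S ≻ 0` and all `F`, with values in the
extended reals. -/
def dualFunction {n m : ℕ} (A : Matrix (Fin n) (Fin n) ℝ) (B : Matrix (Fin n) (Fin m) ℝ)
    (C : Matrix (Fin n) (Fin n) ℝ) (D : Matrix (Fin n) (Fin m) ℝ) (Λ Ξ : BMat n m)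
    (X X₀ : BMat n m) : EReal :=
  ⨅ (S : BMat n m) (_ : S.PosDef) (F : Matrix (Fin m) (Fin n) ℝ),
    (lagrangian A B C D Λ Ξ X F S X₀ : EReal)

/-- `(X, X₀)`, with `X` symmetric and `X₀ ⪰ 0`, maximizes the dual function among such pairs. -/
def DualOptimal {n m : ℕ} (A : Matrix (Fin n) (Fin n) ℝ) (B : Matrix (Fin n) (Fin m) ℝ)
    (C : Matrix (Fin n) (Fin n) ℝ) (D : Matrix (Fin n) (Fin m) ℝ) (Λ Ξ : BMat n m)
    (X X₀ : BMat n m) : Prop :=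
  (X.IsSymm ∧ X₀.PosSemidef) ∧
  ∀ X' X₀' : BMat n m, X'.IsSymm → X₀'.PosSemidef →
    dualFunction A B C D Λ Ξ X' X₀' ≤ dualFunction A B C D Λ Ξ X X₀

/-- `Ψ = [A B] S [A B]' + [C D] S [C D]'`. -/
def Psi {n m : ℕ} (A : Matrix (Fin n) (Fin n) ℝ) (B : Matrix (Fin n) (Fin m) ℝ)
    (C : Matrix (Fin n) (Fin n) ℝ) (D : Matrix (Fin n) (Fin m) ℝ) (S : BMat n m) :
    Matrix (Fin n) (Fin n) ℝ :=
  fromCols A B * S * (fromCols A B)ᵀ + fromCols C D * S * (fromCols C D)ᵀ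

end SLQR

end

namespace SLQR

/-! ### Semidefinite matrices and traces. -/

section Positivity

/-! Everything follows from strong duality. Since `Ξ ≻ 0`, feasibility of `S` is a strict Stein
inequality, so the adjoint equation at `F` with right-hand side `Λ` has a solution `P ⪰ 0`. A
feedback moved slightly from `F` towards the minimizer of the quadratic form given by `P` stays
feasible, and would lower the cost unless `F` already does as well as the minimizer
(`PrimalOptimal.steinOp_le`). Hence `(P, 0)` has dual value at least the primal value `p`.

So the Lagrangian at the dual optimum `(X, X₀)` is at least `p` everywhere. It is affine in `S`,
which gives `p ≤ Tr (X Ξ)` and a semidefinite coefficient `Z`. At the primal optimum it equals `p -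
Tr (X₀ S)`, so `Tr (X₀ S)` and `Tr (Z S)` vanish, and `S ≻ 0` forces `X₀ = Z = 0`. The primal `F`
then minimizes the Lagrangian in the feedback; stationarity is the last condition. -/

theorem isSymm_of_posSemidef {ι : Type*} {P : Matrix ι ι ℝ} (hP : P.PosSemidef) : P.IsSymm := by
  have h := hP.isHermitian
  rwa [IsHermitian, conjTranspose_eq_transpose_of_trivial] at h

variable {ι κ : Type*} [Fintype ι] [Fintype κ]

theorem posSemidef_congr {P : Matrix ι ι ℝ} (hP : P.PosSemidef) (K : Matrix ι κ ℝ) :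
    (Kᵀ * P * K).PosSemidef := by
  simpa [conjTranspose_eq_transpose_of_trivial] using hP.conjTranspose_mul_mul_same K

theorem trace_mul_congr (P : Matrix κ κ ℝ) (Y : Matrix ι ι ℝ) (K : Matrix κ ι ℝ) :
    trace (Kᵀ * P * K * Y) = trace (P * (K * Y * Kᵀ)) := by
  rw [Matrix.mul_assoc, Matrix.mul_assoc, trace_mul_comm, Matrix.mul_assoc]

theorem trace_mul_eq_congr {S : Matrix ι ι ℝ} (hS : S.PosSemidef) :
    ∃ B : Matrix ι ι ℝ, S = B * Bᵀ ∧ ∀ P, trace (P * S) = trace (Bᵀ * P * B) := by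
  classical
  open scoped MatrixOrder in
  obtain ⟨B, hB⟩ := CStarAlgebra.nonneg_iff_eq_mul_star_self.mp hS.nonneg
  refine ⟨B, by simpa [star_eq_conjTranspose, conjTranspose_eq_transpose_of_trivial] using hB,
    fun P => ?_⟩
  rw [hB, star_eq_conjTranspose, conjTranspose_eq_transpose_of_trivial, ← Matrix.mul_assoc,
    trace_mul_comm, Matrix.mul_assoc]

theorem trace_mul_nonneg {P S : Matrix ι ι ℝ} (hP : P.PosSemidef) (hS : S.PosSemidef) :
    0 ≤ trace (P * S) := by
  obtain ⟨B, -, hB⟩ := trace_mul_eq_congr hS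
  rw [hB]
  exact (posSemidef_congr hP B).trace_nonneg

/-- Writing `S = B Bᵀ` with `B` invertible, the semidefinite `Bᵀ P B` has trace zero, hence
vanishes. -/
theorem eq_zero_of_trace_mul_le_zero {P S : Matrix ι ι ℝ} (hP : P.PosSemidef) (hS : S.PosDef)
    (h : trace (P * S) ≤ 0) : P = 0 := by
  classical
  obtain ⟨B, hSB, hB⟩ := trace_mul_eq_congr hS.posSemidef
  have h0 : Bᵀ * P * B = 0 := (posSemidef_congr hP B).trace_eq_zero_iff.mp
    (le_antisymm (hB P ▸ h) (posSemidef_congr hP B).trace_nonneg)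
  have hdet : IsUnit B.det := by
    have := hS.det_pos
    rw [hSB, det_mul, det_transpose] at this
    exact isUnit_iff_ne_zero.mpr (fun h => by simp [h] at this)
  have hdet' : IsUnit Bᵀ.det := by rwa [det_transpose]
  calc P = Bᵀ⁻¹ * (Bᵀ * P * B) * B⁻¹ := by
        rw [Matrix.mul_assoc Bᵀ, nonsing_inv_mul_cancel_left _ _ hdet',
          mul_nonsing_inv_cancel_right _ _ hdet]
    _ = 0 := by rw [h0]; simp

theorem posSemidef_of_trace_mul_nonneg {P : Matrix ι ι ℝ} (hP : P.IsSymm)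
    (h : ∀ S : Matrix ι ι ℝ, S.PosDef → 0 ≤ trace (P * S)) : P.PosSemidef := by
  classical
  refine PosSemidef.of_dotProduct_mulVec_nonneg
    (by rw [IsHermitian, conjTranspose_eq_transpose_of_trivial]; exact hP) fun x => ?_
  have key : ∀ t : ℝ, 0 < t → 0 ≤ x ⬝ᵥ P *ᵥ x + t * trace P := by
    intro t ht
    -- `x xᵀ` is only semidefinite, so it is perturbed by `t • 1` and `t → 0` at the end.
    have hpd : (vecMulVec x x + t • (1 : Matrix ι ι ℝ)).PosDef := by
      refine PosDef.posSemidef_add ?_ (PosDef.one.smul ht)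
      simpa using posSemidef_vecMulVec_self_star x
    have := h _ hpd
    rwa [Matrix.mul_add, trace_add, mul_vecMulVec, trace_vecMulVec, Matrix.mul_smul, trace_smul,
      Matrix.mul_one, dotProduct_comm, smul_eq_mul] at this
  have hlim : Tendsto (fun t : ℝ => x ⬝ᵥ P *ᵥ x + t * trace P) (𝓝[>] 0)
      (𝓝 (x ⬝ᵥ P *ᵥ x + 0 * trace P)) :=
    (Continuous.tendsto (by fun_prop) 0).mono_left nhdsWithin_le_nhds
  have := ge_of_tendsto hlim (by filter_upwards [self_mem_nhdsWithin] with t ht using key t ht)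
  simpa using this

theorem eventually_posDef {G : ℝ → Matrix ι ι ℝ} (hG : Continuous G) (hsymm : ∀ t, (G t).IsSymm)
    (h0 : (G 0).PosDef) : ∀ᶠ t in 𝓝 0, (G t).PosDef := by
  have hcont : Continuous fun p : ℝ × (ι → ℝ) => p.2 ⬝ᵥ G p.1 *ᵥ p.2 := by fun_prop
  have hsph : ∀ᶠ t in 𝓝 (0 : ℝ), ∀ x ∈ Metric.sphere (0 : ι → ℝ) 1, 0 < x ⬝ᵥ G t *ᵥ x := by
    refine (isCompact_sphere _ _).eventually_forall_of_forall_eventually fun x hx => ?_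
    have hx0 : x ≠ 0 := by
      rintro rfl
      simp at hx
    have := h0.dotProduct_mulVec_pos hx0
    exact hcont.continuousAt.eventually (lt_mem_nhds (by simpa using this))
  filter_upwards [hsph] with t ht
  refine PosDef.of_dotProduct_mulVec_pos
    (by rw [IsHermitian, conjTranspose_eq_transpose_of_trivial]; exact hsymm t) fun x hx => ?_
  have hn : 0 < ‖x‖ := norm_pos_iff.mpr hx
  have h1 := ht (‖x‖⁻¹ • x) (by simp [norm_smul, hn.ne'])
  rw [mulVec_smul, smul_dotProduct, dotProduct_smul, smul_eq_mul, smul_eq_mul] at h1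
  have hi : 0 < ‖x‖⁻¹ := inv_pos.mpr hn
  simpa using pos_of_mul_pos_right (pos_of_mul_pos_right h1 hi.le) hi.le

theorem abs_apply_le_trace {P : Matrix ι ι ℝ} (hP : P.PosSemidef) (i j : ι) :
    |P i j| ≤ trace P := by
  classical
  have hsym : P j i = P i j := by simpa using hP.isHermitian.apply i j
  have hdiag : ∀ k, P k k ≤ trace P := fun k =>
    Finset.single_le_sum (f := fun k => P k k) (fun k _ => hP.diag_nonneg) (Finset.mem_univ k)
  have hq : ∀ s : ℝ, 0 ≤ P i i + s * P i j + s * P j i + s * s * P j j := fun s => by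
    have := hP.dotProduct_mulVec_nonneg (Pi.single i 1 + s • Pi.single j 1)
    simp [mulVec_add, mulVec_smul, add_dotProduct, dotProduct_add] at this
    linarith
  have h1 := hq 1
  have h2 := hq (-1)
  have := hdiag i
  have := hdiag j
  rw [abs_le]
  constructor <;> linarith

/-- For small `t > 0`, `Ξ - t • 1` is still positive, so `t * trace P ≤ trace (P * Ξ)`, and the
trace bounds every entry. -/
theorem exists_abs_apply_le_trace_mul {Ξ : Matrix ι ι ℝ} (hΞ : Ξ.PosDef) :
    ∃ c : ℝ, ∀ P : Matrix ι ι ℝ, P.PosSemidef → ∀ i j, |P i j| ≤ c * trace (P * Ξ) := by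
  classical
  have hev := eventually_posDef (G := fun t => Ξ - t • (1 : Matrix ι ι ℝ)) (by fun_prop)
    (fun t => by simp [IsSymm, transpose_sub, (isSymm_of_posSemidef hΞ.posSemidef).eq]) (by simpa using hΞ)
  obtain ⟨t, ht, htpos⟩ :=
    ((hev.filter_mono nhdsWithin_le_nhds).and (self_mem_nhdsWithin (s := Set.Ioi 0))).exists
  refine ⟨t⁻¹, fun P hP i j => (abs_apply_le_trace hP i j).trans ?_⟩
  have := trace_mul_nonneg hP ht.posSemidef
  rw [Matrix.mul_sub, trace_sub, Matrix.mul_smul, trace_smul, Matrix.mul_one, smul_eq_mul] at this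
  rw [inv_mul_eq_div, le_div_iff₀ htpos]
  linarith

end Positivity

/-! ### Generalized Stein equations. -/

section Stein

variable {ι : Type*} [Fintype ι]

/-- The linear operator `X ↦ K' X K + L' X L`. -/
def steinOp (K L : Matrix ι ι ℝ) : Matrix ι ι ℝ →ₗ[ℝ] Matrix ι ι ℝ where
  toFun X := Kᵀ * X * K + Lᵀ * X * L
  map_add' X Y := by simp only [Matrix.mul_add, Matrix.add_mul]; abel
  map_smul' c X := by simp

theorem steinOp_apply (K L X : Matrix ι ι ℝ) : steinOp K L X = Kᵀ * X * K + Lᵀ * X * L := rfl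

theorem steinOp_posSemidef {K L X : Matrix ι ι ℝ} (hX : X.PosSemidef) :
    (steinOp K L X).PosSemidef :=
  (posSemidef_congr hX K).add (posSemidef_congr hX L)

theorem trace_steinOp_mul (K L X S : Matrix ι ι ℝ) :
    trace (steinOp K L X * S) = trace (X * steinOp Kᵀ Lᵀ S) := by
  simp only [steinOp_apply, Matrix.add_mul, Matrix.mul_add, trace_add, transpose_transpose,
    trace_mul_congr]

/-- The solution is the Neumann series `∑ M ^ k W`. Pairing its terms with the strict inequality for
`S` telescopes, which bounds the partial sums. -/
theorem exists_stein_solution {K L S : Matrix ι ι ℝ} (hS : S.PosSemidef)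
    (hlt : (S - steinOp Kᵀ Lᵀ S).PosDef) {W : Matrix ι ι ℝ} (hW : W.PosSemidef) :
    ∃ X : Matrix ι ι ℝ, X.PosSemidef ∧ steinOp K L X + W = X := by
  classical
  set M := steinOp K L
  set Y : ℕ → Matrix ι ι ℝ := fun k => (M ^ k) W with hY
  have hYs : ∀ k, Y (k + 1) = M (Y k) := fun k => by simp [hY, pow_succ']
  have hYpos : ∀ k, (Y k).PosSemidef := fun k => by
    induction k with
    | zero => simpa [hY] using hW
    | succ k ih => rw [hYs]; exact steinOp_posSemidef ih
  have hterm : ∀ k, trace (Y k * (S - steinOp Kᵀ Lᵀ S)) =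
      trace (Y k * S) - trace (Y (k + 1) * S) := fun k => by
    rw [Matrix.mul_sub, trace_sub, hYs, trace_steinOp_mul]
  have hsum : Summable fun k => trace (Y k * (S - steinOp Kᵀ Lᵀ S)) := by
    refine summable_of_sum_range_le (c := trace (Y 0 * S))
      (fun k => trace_mul_nonneg (hYpos k) hlt.posSemidef) fun k => ?_
    simp_rw [hterm]
    rw [Finset.sum_range_sub']
    linarith [trace_mul_nonneg (hYpos k) hS]
  obtain ⟨c, hc⟩ := exists_abs_apply_le_trace_mul hlt
  have hYsum : Summable Y := by
    refine Pi.summable.mpr fun i => Pi.summable.mpr fun j => ?_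
    exact Summable.of_norm_bounded (hsum.mul_left c) fun k => hc _ (hYpos k) i j
  have hfix : M (∑' k, Y k) + W = ∑' k, Y k := by
    have hM : Continuous M := by
      change Continuous fun X => Kᵀ * X * K + Lᵀ * X * L
      fun_prop
    have h1 := hYsum.hasSum.map M hM
    have h2 : (fun k => Y (k + 1)) = M ∘ Y := funext hYs
    have h3 := hYsum.tsum_eq_zero_add
    rw [h2, h1.tsum_eq] at h3
    rw [add_comm]
    exact h3.symm
  refine ⟨∑' k, Y k, ?_, hfix⟩
  refine PosSemidef.of_dotProduct_mulVec_nonneg ?_ fun x => ?_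
  · rw [IsHermitian, conjTranspose_tsum]
    exact tsum_congr fun k => (hYpos k).isHermitian
  · have h := hYsum.hasSum.map (⟨⟨fun P : Matrix ι ι ℝ => star x ⬝ᵥ P *ᵥ x, by simp⟩,
      fun P P' => by simp [add_mulVec, dotProduct_add]⟩ : Matrix ι ι ℝ →+ ℝ)
      (by change Continuous fun P : Matrix ι ι ℝ => star x ⬝ᵥ P *ᵥ x; fun_prop)
    exact h.nonneg fun k => (hYpos k).dotProduct_mulVec_nonneg x

theorem exists_stein_solution_transpose {K L S : Matrix ι ι ℝ} (hS : S.PosSemidef)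
    (hlt : (S - steinOp Kᵀ Lᵀ S).PosDef) {W : Matrix ι ι ℝ} (hW : W.PosSemidef) :
    ∃ Y : Matrix ι ι ℝ, Y.PosSemidef ∧ steinOp Kᵀ Lᵀ Y + W = Y := by
  classical
  -- A solution with right-hand side `1` is a strict certificate for the transposed operator.
  obtain ⟨X, hX, hfix⟩ := exists_stein_solution hS hlt PosSemidef.one
  refine exists_stein_solution hX ?_ hW
  rw [transpose_transpose, transpose_transpose,
    show X - steinOp K L X = 1 from sub_eq_iff_eq_add'.mpr hfix.symm]
  exact PosDef.one

end Stein

/-! ### Dependence on the feedback, and strong duality. -/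

section Feedback

variable {n m : ℕ}

/-- The quadratic form `[I F'] X [I; F]` in the feedback matrix `F`. -/
def gainForm (X : BMat n m) (F : Matrix (Fin m) (Fin n) ℝ) : Matrix (Fin n) (Fin n) ℝ :=
  (fromRows (1 : Matrix (Fin n) (Fin n) ℝ) F)ᵀ * X * fromRows (1 : Matrix (Fin n) (Fin n) ℝ) F

theorem aug_eq_fromRows_mul (M : Matrix (Fin n) (Fin n) ℝ) (N : Matrix (Fin n) (Fin m) ℝ)
    (F : Matrix (Fin m) (Fin n) ℝ) : aug M N F = fromRows 1 F * fromCols M N := by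
  rw [fromRows_mul_fromCols, Matrix.one_mul, Matrix.one_mul, aug]

theorem gainForm_add {X : BMat n m} (hX : X.IsSymm) (F H : Matrix (Fin m) (Fin n) ℝ) :
    gainForm X (F + H) = gainForm X F + Hᵀ * (X.toBlocks₁₂ᵀ + X.toBlocks₂₂ * F)
      + (X.toBlocks₁₂ᵀ + X.toBlocks₂₂ * F)ᵀ * H + Hᵀ * X.toBlocks₂₂ * H := by
  have h21 : X.toBlocks₂₁ = X.toBlocks₁₂ᵀ := by
    ext i j
    exact (hX.apply (Sum.inr i) (Sum.inl j)).symm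
  have h22 : X.toBlocks₂₂ᵀ = X.toBlocks₂₂ := by
    ext i j
    exact hX.apply (Sum.inr i) (Sum.inr j)
  have hexp : ∀ G : Matrix (Fin m) (Fin n) ℝ, gainForm X G =
      X.toBlocks₁₁ + X.toBlocks₁₂ * G + Gᵀ * X.toBlocks₁₂ᵀ + Gᵀ * X.toBlocks₂₂ * G := fun G => by
    rw [gainForm, ← fromBlocks_toBlocks X, transpose_fromRows, fromCols_mul_fromBlocks,
      fromCols_mul_fromRows]
    simp [h21, Matrix.add_mul]
    abel
  rw [hexp, hexp]
  simp only [transpose_add, transpose_mul, transpose_transpose, h22, Matrix.add_mul,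
    Matrix.mul_add, Matrix.mul_assoc]
  abel

variable (A : Matrix (Fin n) (Fin n) ℝ) (B : Matrix (Fin n) (Fin m) ℝ)
  (C : Matrix (Fin n) (Fin n) ℝ) (D : Matrix (Fin n) (Fin m) ℝ)

theorem steinOp_aug (X : BMat n m) (F : Matrix (Fin m) (Fin n) ℝ) :
    steinOp (aug A B F) (aug C D F) X =
      (fromCols A B)ᵀ * gainForm X F * fromCols A B +
        (fromCols C D)ᵀ * gainForm X F * fromCols C D := by
  simp only [steinOp_apply, aug_eq_fromRows_mul, gainForm, transpose_mul, Matrix.mul_assoc]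

theorem trace_steinOp_aug_mul (X S : BMat n m) (F : Matrix (Fin m) (Fin n) ℝ) :
    trace (steinOp (aug A B F) (aug C D F) X * S) = trace (gainForm X F * Psi A B C D S) := by
  rw [steinOp_aug, Psi, Matrix.add_mul, trace_add, Matrix.mul_add, trace_add, trace_mul_congr,
    trace_mul_congr]

theorem lagrangian_eq (Λ Ξ X : BMat n m) (F : Matrix (Fin m) (Fin n) ℝ) (S X₀ : BMat n m) :
    lagrangian A B C D Λ Ξ X F S X₀ =
      trace (X * Ξ) + trace ((steinOp (aug A B F) (aug C D F) X - X - X₀ + Λ) * S) := rfl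

variable {A B C D}

theorem PrimalFeasible.steinOp_eq {Ξ S : BMat n m} {F : Matrix (Fin m) (Fin n) ℝ}
    (h : PrimalFeasible A B C D Ξ S F) :
    steinOp (aug A B F)ᵀ (aug C D F)ᵀ S + Ξ = S := by
  simpa only [steinOp_apply, transpose_transpose] using h.2.1

/-- The multiplier `X` pairs with the equality constraint, so its contribution cancels. -/
theorem lagrangian_eq_of_primalFeasible {Λ Ξ S : BMat n m} {F : Matrix (Fin m) (Fin n) ℝ}
    (h : PrimalFeasible A B C D Ξ S F) (X X₀ : BMat n m) :
    lagrangian A B C D Λ Ξ X F S X₀ = trace (Λ * S) - trace (X₀ * S) := by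
  have := congrArg (fun M => trace (X * M)) h.steinOp_eq
  simp only [Matrix.mul_add, trace_add, ← trace_steinOp_mul] at this
  rw [lagrangian_eq, Matrix.add_mul, Matrix.sub_mul, Matrix.sub_mul, trace_add, trace_sub,
    trace_sub]
  linarith

theorem PrimalFeasible.posDef_sub {Ξ S : BMat n m} {F : Matrix (Fin m) (Fin n) ℝ}
    (h : PrimalFeasible A B C D Ξ S F) (hΞ : Ξ.PosDef) :
    (S - steinOp (aug A B F)ᵀ (aug C D F)ᵀ S).PosDef := by
  rwa [show S - steinOp (aug A B F)ᵀ (aug C D F)ᵀ S = Ξ from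
    sub_eq_iff_eq_add'.mpr h.steinOp_eq.symm]

theorem exists_primalFeasible {Ξ S : BMat n m} (hΞ : Ξ.PosDef) (hS : S.PosSemidef)
    {F : Matrix (Fin m) (Fin n) ℝ} (h : (S - steinOp (aug A B F)ᵀ (aug C D F)ᵀ S).PosDef) :
    ∃ Y : BMat n m, PrimalFeasible A B C D Ξ Y F := by
  obtain ⟨Y, hY, hfix⟩ := exists_stein_solution_transpose hS h hΞ.posSemidef
  refine ⟨Y, ?_, ?_, ?_⟩
  · exact isSymm_of_posSemidef hY
  · simpa only [steinOp_apply, transpose_transpose] using hfix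
  · rw [← hfix]
    exact hΞ.posSemidef_add (steinOp_posSemidef hY)

theorem weight_posSemidef {Q : Matrix (Fin n) (Fin n) ℝ} {R : Matrix (Fin m) (Fin m) ℝ}
    (hQ : Q.PosSemidef) (hR : R.PosDef) : (weight Q R).PosSemidef := by
  have := hR.isUnit.invertible
  simpa [weight] using (Matrix.PosDef.fromBlocks₂₂ Q 0 hR).mpr (by simpa using hQ)

/-- At a primal optimum, the solution of the adjoint Stein equation is not improved by any other
feedback. -/
theorem PrimalOptimal.steinOp_le {Q : Matrix (Fin n) (Fin n) ℝ} {R : Matrix (Fin m) (Fin m) ℝ}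
    (hR : R.PosDef) {Ξ S P : BMat n m} (hΞ : Ξ.PosDef) {F : Matrix (Fin m) (Fin n) ℝ}
    (h : PrimalOptimal A B C D (weight Q R) Ξ S F) (hP : P.PosSemidef)
    (hfix : steinOp (aug A B F) (aug C D F) P + weight Q R = P)
    (F' : Matrix (Fin m) (Fin n) ℝ) :
    (steinOp (aug A B F') (aug C D F') P - steinOp (aug A B F) (aug C D F) P).PosSemidef := by
  have hsymm : P.IsSymm := isSymm_of_posSemidef hP
  have hP22 : P.toBlocks₂₂.PosDef := by
    have h22 : P.toBlocks₂₂ =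
        (steinOp (aug A B F) (aug C D F) P).submatrix Sum.inr Sum.inr + R := by
      ext i j
      exact (congrFun (congrFun hfix (Sum.inr i)) (Sum.inr j)).symm
    rw [h22]
    exact hR.posSemidef_add ((steinOp_posSemidef hP).submatrix _)
  -- The critical point, and minimizer, of `gainForm P`; it exists because `P₂₂ ⪰ R ≻ 0`.
  set G : Matrix (Fin m) (Fin n) ℝ := -(P.toBlocks₂₂⁻¹ * P.toBlocks₁₂ᵀ) with hG
  have hcrit : P.toBlocks₁₂ᵀ + P.toBlocks₂₂ * G = 0 := by
    rw [hG, Matrix.mul_neg, mul_nonsing_inv_cancel_left _ _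
      ((isUnit_iff_isUnit_det _).mp hP22.isUnit), add_neg_cancel]
  have hform : ∀ H, gainForm P (G + H) = gainForm P G + Hᵀ * P.toBlocks₂₂ * H := fun H => by
    rw [gainForm_add hsymm, hcrit]
    simp
  -- The excess over the minimizing feedback `G` is a congruence of `P₂₂`.
  set E : Matrix (Fin m) (Fin n) ℝ → BMat n m := fun H =>
    (fromCols A B)ᵀ * (Hᵀ * P.toBlocks₂₂ * H) * fromCols A B +
      (fromCols C D)ᵀ * (Hᵀ * P.toBlocks₂₂ * H) * fromCols C D with hE
  have hEpos : ∀ H, (E H).PosSemidef := fun H =>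
    (posSemidef_congr (posSemidef_congr hP22.posSemidef H) _).add
      (posSemidef_congr (posSemidef_congr hP22.posSemidef H) _)
  have hstein : ∀ H, steinOp (aug A B (G + H)) (aug C D (G + H)) P =
      steinOp (aug A B G) (aug C D G) P + E H := fun H => by
    rw [steinOp_aug, steinOp_aug, hform, hE]
    simp only [Matrix.mul_add, Matrix.add_mul]
    abel
  have hEsmul : ∀ (c : ℝ) (H), E (c • H) = (c * c) • E H := fun c H => by
    simp only [hE, transpose_smul, Matrix.smul_mul, Matrix.mul_smul, smul_smul, smul_add]
  -- At `t = 0` the feedback is `F`. Strict Stein inequalities are open, so a small step towards `G`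
  -- remains feasible.
  have hcont : ∀ᶠ t in 𝓝 (0 : ℝ), (S - steinOp (aug A B (G + (1 - t) • (F - G)))ᵀ
      (aug C D (G + (1 - t) • (F - G)))ᵀ S).PosDef := by
    refine eventually_posDef ?_ (fun t => ?_) ?_
    · simp only [steinOp_apply, transpose_transpose, aug]
      fun_prop
    · simp only [IsSymm, steinOp_apply, transpose_sub, transpose_add, transpose_mul,
        transpose_transpose, h.1.1.eq, Matrix.mul_assoc]
    · simpa using h.1.posDef_sub hΞ
  obtain ⟨t, ⟨ht, ht1⟩, ht0⟩ := (((hcont.and (gt_mem_nhds one_pos)).filter_mono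
    nhdsWithin_le_nhds).and (self_mem_nhdsWithin (s := Set.Ioi (0 : ℝ)))).exists
  obtain ⟨Y, hY⟩ := exists_primalFeasible hΞ h.1.2.2.posSemidef ht
  have hF : steinOp (aug A B F) (aug C D F) P =
      steinOp (aug A B G) (aug C D G) P + E (F - G) := by
    simpa using hstein (F - G)
  have hE0 : E (F - G) = 0 := by
    refine eq_zero_of_trace_mul_le_zero (hEpos _) hY.2.2 ?_
    have h1 := h.2 _ _ hY
    have h2 := lagrangian_eq_of_primalFeasible (Λ := weight Q R) hY P 0
    have h3 := lagrangian_eq_of_primalFeasible (Λ := weight Q R) h.1 P 0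
    have h4 : steinOp (aug A B F) (aug C D F) P - P - 0 + weight Q R = 0 := by
      rw [sub_zero, sub_add_eq_add_sub, hfix, sub_self]
    -- `E` is quadratic, so the step gains `1 - (1 - t)² = t (2 - t)` times `E (F - G)`.
    have h5 : steinOp (aug A B (G + (1 - t) • (F - G))) (aug C D (G + (1 - t) • (F - G))) P - P - 0
        + weight Q R = -((t * (2 - t)) • E (F - G)) := by
      rw [eq_sub_of_add_eq' hfix, hstein, hEsmul, hF]
      module
    rw [lagrangian_eq, h5] at h2
    rw [lagrangian_eq, h4] at h3
    simp only [Matrix.zero_mul, trace_zero, Matrix.neg_mul, trace_neg, Matrix.smul_mul, trace_smul,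
      smul_eq_mul] at h2 h3
    have ht2 : 0 < t * (2 - t) := mul_pos ht0 (by linarith)
    by_contra hlt
    have := mul_pos ht2 (not_le.mp hlt)
    linarith
  have hF' := hstein (F' - G)
  rw [add_sub_cancel] at hF'
  rw [hF', hF, hE0, add_zero, add_sub_cancel_left]
  exact hEpos _

/-- Strong duality: some dual feasible point attains the primal optimal value. -/
theorem PrimalOptimal.exists_multiplier {Q : Matrix (Fin n) (Fin n) ℝ}
    {R : Matrix (Fin m) (Fin m) ℝ} (hQ : Q.PosSemidef) (hR : R.PosDef) {Ξ S : BMat n m}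
    (hΞ : Ξ.PosDef) {F : Matrix (Fin m) (Fin n) ℝ}
    (h : PrimalOptimal A B C D (weight Q R) Ξ S F) :
    ∃ P : BMat n m, P.IsSymm ∧ ∀ (F' : Matrix (Fin m) (Fin n) ℝ) (S' : BMat n m), S'.PosDef →
      trace (weight Q R * S) ≤ lagrangian A B C D (weight Q R) Ξ P F' S' 0 := by
  obtain ⟨P, hP, hfix⟩ := exists_stein_solution h.1.2.2.posSemidef (h.1.posDef_sub hΞ)
    (weight_posSemidef hQ hR)
  refine ⟨P, isSymm_of_posSemidef hP, fun F' S' hS' => ?_⟩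
  have h1 := trace_mul_nonneg (h.steinOp_le hR hΞ hP hfix F') hS'.posSemidef
  have h2 := lagrangian_eq_of_primalFeasible (Λ := weight Q R) h.1 P 0
  have h4 : steinOp (aug A B F) (aug C D F) P - P - 0 + weight Q R = 0 := by
    rw [sub_zero, sub_add_eq_add_sub, hfix, sub_self]
  have h5 : steinOp (aug A B F') (aug C D F') P - P - 0 + weight Q R =
      steinOp (aug A B F') (aug C D F') P - steinOp (aug A B F) (aug C D F) P := by
    rw [eq_sub_of_add_eq' hfix]
    abel
  rw [lagrangian_eq, h4] at h2
  rw [lagrangian_eq, h5]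
  simp only [Matrix.zero_mul, trace_zero] at h2
  linarith

theorem DualOptimal.le_lagrangian {Λ Ξ X X₀ : BMat n m} (h : DualOptimal A B C D Λ Ξ X X₀)
    {P : BMat n m} (hP : P.IsSymm) {p : ℝ}
    (hp : ∀ (F : Matrix (Fin m) (Fin n) ℝ) (S : BMat n m), S.PosDef →
      p ≤ lagrangian A B C D Λ Ξ P F S 0)
    (F : Matrix (Fin m) (Fin n) ℝ) {S : BMat n m} (hS : S.PosDef) :
    p ≤ lagrangian A B C D Λ Ξ X F S X₀ := by
  have h1 : (p : EReal) ≤ dualFunction A B C D Λ Ξ P 0 :=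
    le_iInf fun S => le_iInf fun hS => le_iInf fun F => EReal.coe_le_coe_iff.mpr (hp F S hS)
  have h2 := h.2 P 0 hP PosSemidef.zero
  have h3 : dualFunction A B C D Λ Ξ X X₀ ≤ (lagrangian A B C D Λ Ξ X F S X₀ : EReal) :=
    (iInf_le _ S).trans ((iInf_le _ hS).trans (iInf_le _ F))
  exact EReal.coe_le_coe_iff.mp (h1.trans (h2.trans h3))

end Feedback

/-! ### Scalar inequalities along a line. -/

theorem nonneg_of_forall_le_add_mul {p a b : ℝ} (h : ∀ t : ℝ, 0 < t → p ≤ a + t * b) :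
    p ≤ a ∧ 0 ≤ b := by
  constructor
  · have hlim : Tendsto (fun t : ℝ => a + t * b) (𝓝[>] 0) (𝓝 (a + 0 * b)) :=
      (Continuous.tendsto (by fun_prop) 0).mono_left nhdsWithin_le_nhds
    have := ge_of_tendsto hlim (by filter_upwards [self_mem_nhdsWithin] with t ht using h t ht)
    simpa using this
  · by_contra! hb
    -- For this `t`, `a + t * b = a - |p - a| - 1 < p`.
    have h1 := h ((|p - a| + 1) / -b) (by apply div_pos (by positivity); linarith)
    have h2 : (|p - a| + 1) / -b * b = -(|p - a| + 1) := by
      have := hb.ne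
      field_simp
    have := neg_abs_le (p - a)
    linarith

theorem eq_zero_of_forall_mul_add_sq_nonneg {a b : ℝ} (h : ∀ t : ℝ, 0 ≤ t * a + t * t * b) :
    a = 0 := by
  have h1 : ∀ c : ℝ, (∀ t : ℝ, 0 < t → 0 ≤ t * c + t * t * b) → 0 ≤ c := fun c hc =>
    (nonneg_of_forall_le_add_mul (p := 0) (a := c) (b := b) fun t ht =>
      nonneg_of_mul_nonneg_right (by linarith [hc t ht]) ht).1
  refine le_antisymm ?_ (h1 a fun t _ => h t)
  have := h1 (-a) fun t _ => by linarith [h (-t)]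
  linarith

end SLQR

/-! ### The KKT conditions. -/

theorem mainTheorem8 {Ω : Type*} [MeasurableSpace Ω] (μ : Measure Ω) [IsProbabilityMeasure μ]
    (w : ℕ → Ω → ℝ) (hw : SLQR.IsNoise μ w) {n m r : ℕ}
    (A : Matrix (Fin n) (Fin n) ℝ) (B : Matrix (Fin n) (Fin m) ℝ)
    (C : Matrix (Fin n) (Fin n) ℝ) (D : Matrix (Fin n) (Fin m) ℝ)
    (Q : Matrix (Fin n) (Fin n) ℝ) (R : Matrix (Fin m) (Fin m) ℝ)
    (hQ : Q.PosSemidef) (hR : R.PosDef)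
    (hstab : SLQR.Stabilizable μ w A B C D)
    (hobs : SLQR.ExactlyObservable μ w A C Q ∨ SLQR.ExactlyDetectable μ w A C Q)
    (v₀ : Fin r → (Fin n ⊕ Fin m → ℝ)) (hΞ : (SLQR.gram v₀).PosDef)
    (S X X₀ : SLQR.BMat n m) (F : Matrix (Fin m) (Fin n) ℝ)
    (hprimal : SLQR.PrimalOptimal A B C D (SLQR.weight Q R) (SLQR.gram v₀) S F)
    (hdual : SLQR.DualOptimal A B C D (SLQR.weight Q R) (SLQR.gram v₀) X X₀) :
    SLQR.aug A B F * S * (SLQR.aug A B F)ᵀ + SLQR.aug C D F * S * (SLQR.aug C D F)ᵀ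
        + SLQR.gram v₀ - S = 0 ∧
      S.PosDef ∧
      (SLQR.aug A B F)ᵀ * X * SLQR.aug A B F + (SLQR.aug C D F)ᵀ * X * SLQR.aug C D F
        + SLQR.weight Q R - X = 0 ∧
      (X.toBlocks₁₂ᵀ + X.toBlocks₂₂ * F) * SLQR.Psi A B C D S = 0 ∧
      X₀ = 0 := by
  obtain ⟨P, hP, hp⟩ := hprimal.exists_multiplier hQ hR hΞ
  have hL := hdual.le_lagrangian hP hp
  have hX : X.IsSymm := hdual.1.1
  have hX₀ : X₀.PosSemidef := hdual.1.2
  have hS : S.PosDef := hprimal.1.2.2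
  set p := trace (SLQR.weight Q R * S)
  set Z := SLQR.steinOp (SLQR.aug A B F) (SLQR.aug C D F) X - X - X₀ + SLQR.weight Q R with hZ
  -- Along the ray `t • S'` the Lagrangian is affine in `t`; `t → 0` and large `t` give the two
  -- bounds.
  have hline : ∀ S' : SLQR.BMat n m, S'.PosDef →
      p ≤ trace (X * SLQR.gram v₀) ∧ 0 ≤ trace (Z * S') := fun S' hS' =>
    SLQR.nonneg_of_forall_le_add_mul fun t ht => by
      have := hL F (hS'.smul ht)
      rwa [SLQR.lagrangian_eq, Matrix.mul_smul, trace_smul, smul_eq_mul] at this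
  have hZpos : Z.PosSemidef := by
    refine SLQR.posSemidef_of_trace_mul_nonneg ?_ fun S' hS' => (hline S' hS').2
    simp only [hZ, IsSymm, SLQR.steinOp_apply, transpose_add, transpose_sub, transpose_mul,
      transpose_transpose, hX.eq, (SLQR.isSymm_of_posSemidef hX₀).eq, (SLQR.isSymm_of_posSemidef (SLQR.weight_posSemidef hQ hR)).eq,
      Matrix.mul_assoc]
  have hval := SLQR.lagrangian_eq_of_primalFeasible (Λ := SLQR.weight Q R) hprimal.1 X X₀
  rw [SLQR.lagrangian_eq] at hval
  have hX₀S := SLQR.trace_mul_nonneg hX₀ hS.posSemidef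
  obtain ⟨hle, hZS⟩ := hline S hS
  have hX₀0 : X₀ = 0 := SLQR.eq_zero_of_trace_mul_le_zero hX₀ hS (by linarith)
  have hZ0 : Z = 0 := SLQR.eq_zero_of_trace_mul_le_zero hZpos hS (by linarith)
  refine ⟨sub_eq_zero.mpr hprimal.1.2.1, hS, ?_, ?_, hX₀0⟩
  · rw [← hZ0, hZ, hX₀0, SLQR.steinOp_apply]
    abel
  · set K := X.toBlocks₁₂ᵀ + X.toBlocks₂₂ * F with hK
    set Ψ := SLQR.Psi A B C D S with hΨ
    have hΨsymm : Ψᵀ = Ψ := by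
      simp only [hΨ, SLQR.Psi, transpose_add, transpose_mul, transpose_transpose,
        hprimal.1.1.eq, Matrix.mul_assoc]
    -- Perturbing `F` in the direction `K * Ψ` makes the first-order term twice the squared
    -- Frobenius norm of `K * Ψ`.
    have hquad : ∀ t : ℝ, 0 ≤ t * (2 * trace ((K * Ψ)ᵀ * K * Ψ)) +
        t * t * trace ((K * Ψ)ᵀ * X.toBlocks₂₂ * (K * Ψ) * Ψ) := fun t => by
      have h1 := hL (F + t • (K * Ψ)) hS
      rw [SLQR.lagrangian_eq, Matrix.add_mul, Matrix.sub_mul, Matrix.sub_mul, trace_add, trace_sub,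
        trace_sub, SLQR.trace_steinOp_aug_mul, SLQR.gainForm_add hX, ← hK, ← hΨ] at h1
      rw [Matrix.add_mul, Matrix.sub_mul, Matrix.sub_mul, trace_add, trace_sub, trace_sub,
        SLQR.trace_steinOp_aug_mul, ← hΨ] at hval
      have h2 : trace (Kᵀ * (K * Ψ) * Ψ) = trace ((K * Ψ)ᵀ * K * Ψ) := by
        rw [← trace_transpose]
        simp only [transpose_mul, transpose_transpose, hΨsymm]
        rw [trace_mul_comm]
      simp only [transpose_smul, Matrix.smul_mul, Matrix.mul_smul, Matrix.add_mul, trace_add,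
        trace_smul, smul_eq_mul, smul_smul, h2] at h1
      simp only [Matrix.mul_assoc] at h1 hval ⊢
      linarith
    have h0 := SLQR.eq_zero_of_forall_mul_add_sq_nonneg hquad
    have h1 : trace ((K * Ψ)ᴴ * (K * Ψ)) = 0 := by
      rw [conjTranspose_eq_transpose_of_trivial, ← Matrix.mul_assoc]
      linarith
    exact trace_conjTranspose_mul_self_eq_zero_iff.mp h1
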